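/- Let $d\in\mathbb N$, let $(\Omega,\mathcal F,P)$ be a probability space, and let $\mathbb X=\{X_t : t\in\mathbb R^d\}$ be a real-valued Gaussian process on it with mean function $\mu(t)=E[X_t]$ and covariance kernel $k(s,t)=\operatorname{Cov}(X_s,X_t)$. Suppose that $\mu$ is continuous on $\mathbb R^d$ and that, for some $\gamma>0$, $k$ is $\gamma$-Hölder continuous on $\mathbb R^d\times\mathbb R^d$, i.e. there is a constant $C\ge 0$ with $$|k(s,t)-k(s',t')|\le C\,|(s,t)-(s',t')|^{\gamma}\qquad\text{for all } s,t,s',t'\in\mathbb R^d .$$ Then $\mathbb X$ has a version with almost surely continuous sample paths: there is a process $\mathbb Y=\{Y_t : t\in\mathbb R^d\}$ of real random variables on $(\Omega,\mathcal F,P)$ such that $P(Y_t=X_t)=1$ for every $t\in\mathbb R^d$, and, for $P$-almost every $\omega$, the path $t\mapsto Y_t(\omega)$ is continuous on $\mathbb R^d$. -/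

import Mathlib

open MeasureTheory ProbabilityTheory
open scoped NNReal

/-- `Y` is a version (also called a modification) of the real process `X` on the probability
space `(Ω, P)`: `Y` is again a stochastic process (each `Y t` is a random variable on the same
space) and, for every fixed index `t`, `Y t = X t` almost surely. -/
def IsVersion {Ω T : Type*} [MeasurableSpace Ω] (Y X : T → Ω → ℝ) (P : Measure Ω) : Prop :=
  (∀ t, Measurable (Y t)) ∧ ∀ t, Y t =ᵐ[P] X t

open Filter Topology

/-! After centring, an increment over distance `δ` is Gaussian with variance at most `2 * C * δ ^
γ`. Gaussian tails beat every power, so even a tiny `γ` suffices: for `p` large, a union bound over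
the at most `9 ^ d * 16 ^ (d * n)` pairs in the level-`n` dyadic grid is summable. By
Borel–Cantelli, almost surely the oscillation over close grid points decays geometrically, so values
at dyadic roundings converge to a continuous path. The same tail bound, applied to `t` and its
roundings, identifies the limit; adding back the continuous mean finishes. -/

/-! ### Deterministic chaining -/

/-- If the oscillation of `f` over close pairs of the finite sets `G n` decays geometrically, and
`π n` are projections onto `G n`, then `f ∘ π n` converges pointwise to a continuous function. -/
theorem exists_continuous_tendsto_of_oscillation_le {T : Type*} [PseudoMetricSpace T]
    {G : ℕ → Finset T} {π : ℕ → T → T} {A r : ℝ} (hA : 0 ≤ A) (hr0 : 0 ≤ r) (hr1 : r < 1)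
    (hπ : ∀ n x, dist (π n x) x ≤ A * (1 / 2) ^ n)
    (hG : ∀ x, ∃ N, ∀ n ≥ N, ∀ y ∈ Metric.ball x 1, π n y ∈ G n ∧ π n y ∈ G (n + 1))
    {f : T → ℝ}
    (hf : ∀ᶠ n in atTop, ∀ u ∈ G n, ∀ v ∈ G n, dist u v ≤ (4 * A + 1) * (1 / 2) ^ n →
      |f u - f v| ≤ r ^ n) :
    ∃ g : T → ℝ, Continuous g ∧ ∀ x, Tendsto (fun n => f (π n x)) atTop (𝓝 (g x)) := by
  obtain ⟨N₀, hN₀⟩ := eventually_atTop.1 hf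
  have key : ∀ x, ∃ N ≥ N₀, ∀ n ≥ N, ∀ y ∈ Metric.ball x 1,
      (π n y ∈ G n) ∧ dist (f (π n y)) (f (π (n + 1) y)) ≤ 1 * r ^ n := by
    intro x
    obtain ⟨N, hN⟩ := hG x
    refine ⟨max N N₀, le_max_right _ _, fun n hn y hy => ?_⟩
    have hn1 := le_of_max_le_left hn
    have hn0 := le_of_max_le_right hn
    refine ⟨(hN n hn1 y hy).1, ?_⟩
    -- Consecutive projections both lie in the finer grid, at distance at most `3 * A * (1 / 2) ^ (n
    -- + 1)`.
    have h := hN₀ (n + 1) (by omega) _ (hN n hn1 y hy).2 _ (hN (n + 1) (by omega) y hy).1 ?_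
    · rw [Real.dist_eq, one_mul]
      exact h.trans (pow_le_pow_of_le_one hr0 hr1.le (Nat.le_succ n))
    · have h1 := hπ n y
      have h2 := hπ (n + 1) y
      have h3 := dist_triangle_right (π n y) (π (n + 1) y) y
      have h4 : (0 : ℝ) < (1 / 2) ^ n := by positivity
      rw [pow_succ] at h2 ⊢
      nlinarith
  have hlim : ∀ x, ∃ z, Tendsto (fun n => f (π n x)) atTop (𝓝 z) := by
    intro x
    obtain ⟨N, -, hN⟩ := key x
    have hc : CauchySeq fun n => f (π (n + N) x) :=
      cauchySeq_of_le_geometric r (r ^ N) hr1 fun n => by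
        have := (hN (n + N) (by omega) x (Metric.mem_ball_self one_pos)).2
        rw [one_mul, pow_add, mul_comm] at this
        rwa [show n + 1 + N = n + N + 1 by ring]
    obtain ⟨z, hz⟩ := cauchySeq_tendsto_of_complete hc
    exact ⟨z, (tendsto_add_atTop_iff_nat N).1 hz⟩
  choose g hg using hlim
  refine ⟨g, ?_, hg⟩
  have hgN : ∀ x, ∃ N ≥ N₀, ∀ n ≥ N, ∀ y ∈ Metric.ball x 1,
      π n y ∈ G n ∧ dist (f (π n y)) (g y) ≤ r ^ n / (1 - r) := by
    intro x
    obtain ⟨N, hN0, hN⟩ := key x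
    refine ⟨N, hN0, fun n hn y hy => ⟨(hN n hn y hy).1, ?_⟩⟩
    have := dist_le_of_le_geometric_of_tendsto₀ r (r ^ n) hr1 (f := fun m => f (π (m + n) y))
      (fun m => by
        have := (hN (m + n) (by omega) y hy).2
        rw [one_mul, pow_add, mul_comm] at this
        rwa [show m + 1 + n = m + n + 1 by ring])
      ((tendsto_add_atTop_iff_nat n).2 (hg y))
    simpa using this
  refine continuous_iff_continuousAt.2 fun x => Metric.continuousAt_iff.2 fun ε hε => ?_
  obtain ⟨N, hN0, hN⟩ := hgN x
  have hlim0 : Tendsto (fun n => r ^ n / (1 - r) + r ^ n + r ^ n / (1 - r)) atTop (𝓝 0) := by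
    have := tendsto_pow_atTop_nhds_zero_of_lt_one hr0 hr1
    simpa using ((this.div_const (1 - r)).add this).add (this.div_const (1 - r))
  obtain ⟨n, hn, hnε⟩ := ((hlim0.eventually (gt_mem_nhds hε)).and (eventually_ge_atTop N)).exists
  refine ⟨(1 / 2) ^ n, by positivity, fun y hy => ?_⟩
  have hx1 := hN n hnε x (Metric.mem_ball_self one_pos)
  have hy1 := hN n hnε y (hy.trans_le (pow_le_one₀ (by norm_num) (by norm_num)))
  -- Here the distance is at most `(2 * A + 1) * (1 / 2) ^ n`; `4 * A + 1` covers both uses.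
  have hxy := hN₀ n (hN0.trans hnε) _ hy1.1 _ hx1.1 <| by
    have h1 := hπ n y
    have h2 := hπ n x
    have h3 := dist_triangle4_right (π n y) (π n x) y x
    have h4 : (0 : ℝ) < (1 / 2) ^ n := by positivity
    nlinarith
  rw [← Real.dist_eq] at hxy
  calc dist (g y) (g x) ≤ dist (g y) (f (π n y)) + dist (f (π n y)) (f (π n x))
        + dist (f (π n x)) (g x) := dist_triangle4 _ _ _ _
    _ ≤ r ^ n / (1 - r) + r ^ n + r ^ n / (1 - r) := by
        gcongr
        · rw [dist_comm]; exact hy1.2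
        · exact hx1.2
    _ < ε := hn

/-! ### Gaussian tails -/

/-- Polynomial tail bounds for centred real Gaussian laws, uniform in the variance. -/
theorem exists_measureReal_gaussianReal_abs_ge_le (p : ℕ) :
    ∃ K : ℝ, 0 ≤ K ∧ ∀ (v : ℝ≥0) (a : ℝ), 0 < a →
      (gaussianReal 0 v).real {x | a ≤ |x|} ≤ K * (v / a ^ 2) ^ p := by
  -- `K` is the standard normal moment of order `2 * p`: rescale by `√v`, then apply Markov.
  refine ⟨∫ x, (x ^ 2) ^ p ∂gaussianReal 0 1, by positivity, fun v a ha => ?_⟩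
  have hv : gaussianReal 0 v = (gaussianReal 0 1).map (√(v : ℝ) * ·) := by
    rw [gaussianReal_map_const_mul]
    congr 1
    · simp
    · ext; simp
  have hint : Integrable (fun x : ℝ => (x ^ 2) ^ p) (gaussianReal 0 1) := by
    have := (memLp_id_gaussianReal (μ := 0) (v := 1) ((2 * p : ℕ) : ℝ≥0)).integrable_norm_pow'
    simpa [pow_mul] using this
  rw [hv, map_measureReal_apply (by fun_prop) (measurableSet_le (by fun_prop) (by fun_prop))]
  have hsub : (fun x => √(v : ℝ) * x) ⁻¹' {x | a ≤ |x|} ⊆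
      {x : ℝ | (a ^ 2) ^ p ≤ (v : ℝ) ^ p * (x ^ 2) ^ p} := by
    intro x hx
    simp only [Set.mem_preimage, Set.mem_ofPred_eq] at hx ⊢
    rw [← mul_pow]
    refine pow_le_pow_left₀ (by positivity) ?_ p
    have := pow_le_pow_left₀ ha.le hx 2
    rwa [sq_abs, mul_pow, Real.sq_sqrt v.coe_nonneg] at this
  have hM := mul_meas_ge_le_integral_of_nonneg (μ := gaussianReal 0 1)
    (f := fun x => (v : ℝ) ^ p * (x ^ 2) ^ p) (ae_of_all _ fun x => by positivity)
    (hint.const_mul _) ((a ^ 2) ^ p)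
  rw [integral_const_mul] at hM
  refine (measureReal_mono hsub).trans ?_
  rw [div_pow, mul_div_assoc', le_div_iff₀ (by positivity)]
  linarith

/-! ### Dyadic grids -/

/-- The points of the lattice `2⁻ⁿ ℤᵈ` in the cube `[-2ⁿ, 2ⁿ]ᵈ`. -/
noncomputable def dyadicGrid (d n : ℕ) : Finset (EuclideanSpace ℝ (Fin d)) :=
  (Fintype.piFinset fun _ : Fin d => Finset.Icc (-4 ^ n : ℤ) (4 ^ n)).image
    fun z => WithLp.toLp 2 fun i => (z i : ℝ) / 2 ^ n

/-- Coordinatewise rounding down to the lattice `2⁻ⁿ ℤᵈ`. -/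
noncomputable def dyadicFloor {d : ℕ} (n : ℕ) (x : EuclideanSpace ℝ (Fin d)) :
    EuclideanSpace ℝ (Fin d) :=
  WithLp.toLp 2 fun i => (⌊2 ^ n * x i⌋ : ℝ) / 2 ^ n

theorem card_dyadicGrid_le (d n : ℕ) : (dyadicGrid d n).card ≤ 3 ^ d * (4 ^ d) ^ n := by
  refine Finset.card_image_le.trans ?_
  rw [Fintype.card_piFinset_const, Int.card_Icc, ← pow_mul, mul_comm d n, pow_mul,
    ← mul_pow]
  refine Nat.pow_le_pow_left ?_ d
  have : (0 : ℤ) < 4 ^ n := by positivity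
  zify
  rw [Int.toNat_of_nonneg (by linarith)]
  have : (1 : ℤ) ≤ 4 ^ n := by linarith
  linarith

theorem dist_dyadicFloor_le {d : ℕ} (n : ℕ) (x : EuclideanSpace ℝ (Fin d)) :
    dist (dyadicFloor n x) x ≤ √d * (1 / 2) ^ n := by
  rw [EuclideanSpace.dist_eq]
  have h : ∀ i, dist (dyadicFloor n x i) (x i) ^ 2 ≤ ((1 / 2) ^ n) ^ 2 := by
    intro i
    refine pow_le_pow_left₀ dist_nonneg ?_ 2
    have h1 := Int.floor_le (2 ^ n * x i)
    have h2 := Int.lt_floor_add_one (2 ^ n * x i)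
    have h3 : (0 : ℝ) < 2 ^ n := by positivity
    have h4 : dyadicFloor n x i - x i = (⌊2 ^ n * x i⌋ - 2 ^ n * x i) * (1 / 2) ^ n := by
      simp only [dyadicFloor, one_div, inv_pow]
      field_simp
    rw [Real.dist_eq, h4, abs_mul, abs_of_pos (a := (1 / 2 : ℝ) ^ n) (by positivity)]
    refine mul_le_of_le_one_left (by positivity) (abs_le.2 ⟨by linarith, by linarith⟩)
  calc √(∑ i, dist (dyadicFloor n x i) (x i) ^ 2)
      ≤ √(∑ _i : Fin d, ((1 / 2) ^ n) ^ 2) := Real.sqrt_le_sqrt (Finset.sum_le_sum fun i _ => h i)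
    _ = √d * (1 / 2) ^ n := by
      rw [Finset.sum_const, Finset.card_univ, Fintype.card_fin, nsmul_eq_mul,
        Real.sqrt_mul (by positivity), Real.sqrt_sq (by positivity)]

/-- The finer grid contains the point because `z / 2 ^ n = 2 * z / 2 ^ (n + 1)`; chaining compares
successive levels there. -/
theorem dyadicFloor_mem_dyadicGrid {d : ℕ} {n : ℕ} {x : EuclideanSpace ℝ (Fin d)}
    (hx : ‖x‖ ≤ 2 ^ n) :
    dyadicFloor n x ∈ dyadicGrid d n ∧ dyadicFloor n x ∈ dyadicGrid d (n + 1) := by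
  have hb : ∀ i, -4 ^ n ≤ ⌊2 ^ n * x i⌋ ∧ ⌊2 ^ n * x i⌋ ≤ 4 ^ n := by
    intro i
    have h1 := abs_le.1 (((Real.norm_eq_abs _).symm.le.trans (PiLp.norm_apply_le x i)).trans hx)
    have h4 : (4 : ℝ) ^ n = 2 ^ n * 2 ^ n := by rw [← mul_pow]; norm_num
    have h3 : (0 : ℝ) < 2 ^ n := by positivity
    refine ⟨Int.le_floor.2 ?_, (Int.cast_le (R := ℝ)).1 ((Int.floor_le _).trans ?_)⟩
    · push_cast; nlinarith
    · push_cast; nlinarith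
  have h4 : (0 : ℤ) < 4 ^ n := by positivity
  constructor
  · refine Finset.mem_image.2 ⟨fun i => ⌊2 ^ n * x i⌋, ?_, rfl⟩
    simpa [Fintype.mem_piFinset] using hb
  · refine Finset.mem_image.2 ⟨fun i => 2 * ⌊2 ^ n * x i⌋, ?_, ?_⟩
    · simp only [Fintype.mem_piFinset, Finset.mem_Icc, pow_succ]
      intro i
      have := hb i
      constructor <;> linarith
    · simp only [dyadicFloor]
      congr 1
      ext i
      push_cast
      rw [pow_succ]
      field_simp

theorem eventually_dyadicFloor_mem_dyadicGrid {d : ℕ} (x : EuclideanSpace ℝ (Fin d)) :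
    ∃ N, ∀ n ≥ N, ∀ y ∈ Metric.ball x 1,
      dyadicFloor n y ∈ dyadicGrid d n ∧ dyadicFloor n y ∈ dyadicGrid d (n + 1) := by
  obtain ⟨N, hN⟩ := pow_unbounded_of_one_lt (‖x‖ + 1) one_lt_two
  refine ⟨N, fun n hn y hy => dyadicFloor_mem_dyadicGrid ?_⟩
  have h1 : ‖y‖ ≤ ‖x‖ + ‖y - x‖ := norm_le_norm_add_norm_sub' y x
  have h2 : ‖y - x‖ < 1 := by rwa [← dist_eq_norm]
  have h3 : (2 : ℝ) ^ N ≤ 2 ^ n := pow_le_pow_right₀ one_le_two hn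
  linarith

/-! ### Kolmogorov–Chentsov -/

/-- Borel–Cantelli for events of geometrically decaying probability. -/
theorem ae_eventually_notMem_of_measureReal_le_geometric {Ω : Type*} [MeasurableSpace Ω]
    {P : Measure Ω} [IsFiniteMeasure P] {s : ℕ → Set Ω} {M ρ : ℝ} (hρ0 : 0 ≤ ρ) (hρ1 : ρ < 1)
    (hs : ∀ n, P.real (s n) ≤ M * ρ ^ n) : ∀ᵐ ω ∂P, ∀ᶠ n in atTop, ω ∉ s n := by
  refine ae_eventually_notMem (ne_top_of_le_ne_top
    ((summable_geometric_of_lt_one hρ0 hρ1).mul_left M).tsum_ofReal_ne_top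
    (ENNReal.tsum_le_tsum fun n => ?_))
  rw [← ofReal_measureReal (measure_ne_top P (s n))]
  exact ENNReal.ofReal_le_ofReal (hs n)

/-- A form of the Kolmogorov–Chentsov theorem: a measurable real process on `ℝᵈ` whose increments
have polynomially decaying tails of every order has a modification with continuous paths. -/
theorem exists_continuous_modification {Ω : Type*} [MeasurableSpace Ω] (P : Measure Ω)
    [IsProbabilityMeasure P] {d : ℕ} {Z : EuclideanSpace ℝ (Fin d) → Ω → ℝ}
    (hZ : ∀ t, Measurable (Z t)) {γ : ℝ} (hγ : 0 < γ)
    (htail : ∀ p : ℕ, ∃ K : ℝ, 0 ≤ K ∧ ∀ s t, ∀ a > 0,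
      P.real {ω | a ≤ |Z s ω - Z t ω|} ≤ K * (dist s t ^ γ / a ^ 2) ^ p) :
    ∃ Y : EuclideanSpace ℝ (Fin d) → Ω → ℝ, (∀ t, Measurable (Y t)) ∧ (∀ t, Y t =ᵐ[P] Z t) ∧
      ∀ ω, Continuous fun t => Y t ω := by
  set A : ℝ := √d
  -- With `r ^ 4 = 2 ^ (-γ)`, dividing by the squared threshold `r ^ (2 * n)` still leaves decay `r
  -- ^ (2 * n)`.
  set r : ℝ := ((1 / 2 : ℝ) ^ γ) ^ (1 / 4 : ℝ) with hr
  have hr0 : 0 < r := by positivity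
  have hr1 : r < 1 := Real.rpow_lt_one (by positivity)
    (Real.rpow_lt_one (by norm_num) (by norm_num) hγ) (by norm_num)
  have hr4 : (1 / 2 : ℝ) ^ γ = r ^ 4 := by
    rw [hr, ← Real.rpow_natCast, ← Real.rpow_mul (by positivity)]; norm_num
  -- The order `p` must beat the growth factor `16 ^ d` of the number of pairs.
  obtain ⟨p, hp⟩ : ∃ p : ℕ, (r ^ 2) ^ p < 1 / 16 ^ d :=
    exists_pow_lt_of_lt_one (by positivity) (pow_lt_one₀ hr0.le hr1 (by norm_num))
  set ρ : ℝ := 16 ^ d * (r ^ 2) ^ p with hρ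
  have hρ0 : 0 ≤ ρ := by positivity
  have hρ1 : ρ < 1 := by rwa [lt_div_iff₀ (by positivity), mul_comm] at hp
  obtain ⟨K, hK0, hK⟩ := htail p
  have hdist : ∀ (B : ℝ), 0 ≤ B → ∀ n s t, dist s t ≤ B * (1 / 2) ^ n →
      P.real {ω | r ^ n ≤ |Z s ω - Z t ω|} ≤ K * (B ^ γ) ^ p * ((r ^ 2) ^ p) ^ n := by
    intro B hB n s t hst
    refine (hK s t _ (pow_pos hr0 n)).trans ?_
    rw [mul_assoc, pow_right_comm (r ^ 2), ← mul_pow]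
    gcongr
    rw [div_le_iff₀ (by positivity)]
    calc dist s t ^ γ ≤ (B * (1 / 2) ^ n) ^ γ := Real.rpow_le_rpow dist_nonneg hst hγ.le
      _ = B ^ γ * (r ^ 4) ^ n := by
        rw [Real.mul_rpow hB (by positivity), ← hr4, ← Real.rpow_natCast, ← Real.rpow_natCast,
          ← Real.rpow_mul (by norm_num), ← Real.rpow_mul (by norm_num), mul_comm γ]
      _ = B ^ γ * (r ^ 2) ^ n * (r ^ n) ^ 2 := by ring
  set I : ℕ → Finset (EuclideanSpace ℝ (Fin d) × EuclideanSpace ℝ (Fin d)) := fun n =>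
    (dyadicGrid d n ×ˢ dyadicGrid d n).filter fun q => dist q.1 q.2 ≤ (4 * A + 1) * (1 / 2) ^ n
  set bad : ℕ → Set Ω := fun n => ⋃ q ∈ I n, {ω | r ^ n ≤ |Z q.1 ω - Z q.2 ω|}
  set M : ℝ := 9 ^ d * (K * ((4 * A + 1) ^ γ) ^ p) with hM
  have hbound : ∀ n, P.real (bad n) ≤ M * ρ ^ n := by
    intro n
    have hcard : ((I n).card : ℝ) ≤ 9 ^ d * (16 ^ d) ^ n := by
      have h1 : ((I n).card : ℝ) ≤ ((dyadicGrid d n).card : ℝ) * (dyadicGrid d n).card := by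
        exact_mod_cast (Finset.card_filter_le _ _).trans (Finset.card_product _ _).le
      have h2 : ((dyadicGrid d n).card : ℝ) ≤ 3 ^ d * (4 ^ d) ^ n := by
        exact_mod_cast card_dyadicGrid_le d n
      calc _ ≤ _ := h1
        _ ≤ (3 ^ d * (4 ^ d) ^ n) * (3 ^ d * (4 ^ d) ^ n) :=
          mul_self_le_mul_self (Nat.cast_nonneg _) h2
        _ = 9 ^ d * (16 ^ d) ^ n := by
          rw [mul_mul_mul_comm, ← mul_pow, ← mul_pow, ← mul_pow,
            show (3 : ℝ) * 3 = 9 by norm_num, show (4 : ℝ) * 4 = 16 by norm_num]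
    calc P.real (bad n) ≤ ∑ q ∈ I n, P.real {ω | r ^ n ≤ |Z q.1 ω - Z q.2 ω|} :=
          measureReal_biUnion_finset_le _ _
      _ ≤ ∑ _q ∈ I n, K * ((4 * A + 1) ^ γ) ^ p * ((r ^ 2) ^ p) ^ n :=
          Finset.sum_le_sum fun q hq =>
            hdist _ (by positivity) n _ _ (Finset.mem_filter.1 hq).2
      _ = (I n).card * (K * ((4 * A + 1) ^ γ) ^ p * ((r ^ 2) ^ p) ^ n) := by
          rw [Finset.sum_const, nsmul_eq_mul]
      _ ≤ (9 ^ d * (16 ^ d) ^ n) * (K * ((4 * A + 1) ^ γ) ^ p * ((r ^ 2) ^ p) ^ n) := by gcongr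
      _ = M * ρ ^ n := by rw [hM, hρ, mul_pow]; ring
  have hgood := ae_eventually_notMem_of_measureReal_le_geometric hρ0 hρ1 hbound
  -- Zeroing paths off a measurable full set keeps the limit measurable and every path continuous.
  obtain ⟨E, hEsub, hEmeas, hE⟩ := hgood.exists_measurable_mem
  have hpath : ∀ ω, ∃ g : EuclideanSpace ℝ (Fin d) → ℝ, Continuous g ∧
      ∀ x, Tendsto (fun n => E.indicator (Z (dyadicFloor n x)) ω) atTop (𝓝 (g x)) := by
    intro ω
    by_cases hω : ω ∈ E
    · simp only [Set.indicator_of_mem hω]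
      refine exists_continuous_tendsto_of_oscillation_le (A := A) (by positivity) hr0.le hr1
        dist_dyadicFloor_le eventually_dyadicFloor_mem_dyadicGrid (f := fun t => Z t ω) ?_
      filter_upwards [hE ω hω] with n hn u hu v hv huv
      by_contra! h
      exact hn (Set.mem_biUnion (x := (u, v))
        (Finset.mem_filter.2 ⟨Finset.mem_product.2 ⟨hu, hv⟩, huv⟩) h.le)
    · exact ⟨fun _ => 0, continuous_const, fun x => by simp [hω]⟩
  choose g hgc hg using hpath
  refine ⟨fun t ω => g ω t, fun t => ?_, fun t => ?_, hgc⟩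
  · exact measurable_of_tendsto_metrizable
      (fun n => (hZ (dyadicFloor n t)).indicator hEmeas) (tendsto_pi_nhds.2 fun ω => hg ω t)
  · have hlim : ∀ᵐ ω ∂P, Tendsto (fun n => Z (dyadicFloor n t) ω) atTop (𝓝 (g ω t)) := by
      filter_upwards [hEsub] with ω hω
      simpa [Set.indicator_of_mem hω] using hg ω t
    -- Only one pair per level, so no counting factor is needed.
    have hsum : ∀ᵐ ω ∂P, ∀ᶠ n in atTop,
        ω ∉ {ω | r ^ n ≤ |Z (dyadicFloor n t) ω - Z t ω|} :=
      ae_eventually_notMem_of_measureReal_le_geometric (by positivity)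
        ((le_mul_of_one_le_left (by positivity) (one_le_pow₀ (by norm_num))).trans_lt hρ1)
        fun n => hdist A (by positivity) n _ _ (dist_dyadicFloor_le n t)
    filter_upwards [hlim, hsum] with ω h1 h2
    refine tendsto_nhds_unique h1 (tendsto_iff_dist_tendsto_zero.2 ?_)
    refine squeeze_zero' (.of_forall fun n => dist_nonneg) ?_
      (tendsto_pow_atTop_nhds_zero_of_lt_one hr0.le hr1)
    filter_upwards [h2] with n hn
    exact (not_le.1 hn).le

/-! ### Increments of the Gaussian process -/

/-- Tail bound for the centred increments of a Gaussian process in terms of their variance. -/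
theorem ProbabilityTheory.IsGaussianProcess.measureReal_abs_sub_ge {Ω T : Type*}
    [MeasurableSpace Ω] {P : Measure Ω} {X : T → Ω → ℝ} (hX : IsGaussianProcess X P) (s t : T)
    (a : ℝ) :
    P.real {ω | a ≤ |(X s ω - P[X s]) - (X t ω - P[X t])|} =
      (gaussianReal 0 (Var[X s - X t; P]).toNNReal).real {x | a ≤ |x|} := by
  have hlaw : HasLaw (X s - X t) (gaussianReal (P[X s] - P[X t]) (Var[X s - X t; P]).toNNReal) P :=
    ⟨hX.hasGaussianLaw_sub.aemeasurable, by
      rw [hX.hasGaussianLaw_sub.map_eq_gaussianReal]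
      congr 1
      exact integral_sub (hX.hasGaussianLaw_eval s).integrable (hX.hasGaussianLaw_eval t).integrable⟩
  have h := gaussianReal_sub_const hlaw (P[X s] - P[X t])
  rw [sub_self] at h
  rw [← h.map_eq, map_measureReal_apply_of_aemeasurable h.aemeasurable
    (measurableSet_le (by fun_prop) (by fun_prop))]
  congr 1
  ext ω
  simp only [Set.mem_preimage, Set.mem_ofPred_eq, Pi.sub_apply]
  rw [sub_sub_sub_comm]

/-- A Hölder covariance kernel controls the variance of increments. -/
theorem variance_sub_le_of_holderWith_covariance {Ω T : Type*} [MeasurableSpace Ω]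
    [PseudoMetricSpace T] {P : Measure Ω} [IsProbabilityMeasure P] {X : T → Ω → ℝ}
    (hX : ∀ t, MemLp (X t) 2 P) {C γ : ℝ≥0}
    (hk : HolderWith C γ fun p : T × T => cov[X p.1, X p.2; P]) (s t : T) :
    Var[X s - X t; P] ≤ 2 * C * dist s t ^ (γ : ℝ) := by
  -- The variance is `(k(s,s) - k(s,t)) + (k(t,t) - k(s,t))`; each difference moves one argument
  -- only.
  have h1 := hk.dist_le (s, s) (s, t)
  have h2 := hk.dist_le (t, t) (s, t)
  simp only [Prod.dist_eq, dist_self, Real.dist_eq, dist_nonneg, max_eq_right, max_eq_left] at h1 h2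
  rw [dist_comm t s] at h2
  rw [variance_sub (hX s) (hX t), ← covariance_self (hX s).aemeasurable,
    ← covariance_self (hX t).aemeasurable]
  linarith [le_abs_self (cov[X s, X s; P] - cov[X s, X t; P]),
    le_abs_self (cov[X t, X t; P] - cov[X s, X t; P])]

theorem lemma4p1 {Ω : Type*} [MeasurableSpace Ω] (P : Measure Ω) [IsProbabilityMeasure P]
    (d : ℕ) (X : EuclideanSpace ℝ (Fin d) → Ω → ℝ)
    (μ : EuclideanSpace ℝ (Fin d) → ℝ)
    (k : EuclideanSpace ℝ (Fin d) → EuclideanSpace ℝ (Fin d) → ℝ)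
    (hX : IsGaussianProcess X P)
    (hmean : ∀ t, ∫ ω, X t ω ∂P = μ t)
    (hcov : ∀ s t, covariance (X s) (X t) P = k s t)
    (hμ : Continuous μ)
    (γ : ℝ≥0) (hγ : 0 < γ)
    (hk : MemHolder γ
      (fun p : EuclideanSpace ℝ (Fin d) × EuclideanSpace ℝ (Fin d) => k p.1 p.2)) :
    ∃ Y : EuclideanSpace ℝ (Fin d) → Ω → ℝ,
      IsVersion Y X P ∧ ∀ᵐ ω ∂P, Continuous (fun t => Y t ω) := by
  obtain ⟨C, hC⟩ := hk
  simp only [← hcov] at hC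
  have hvar := variance_sub_le_of_holderWith_covariance
    (fun t => (hX.hasGaussianLaw_eval t).memLp_two) hC
  -- A Gaussian process is only a.e. measurable, whereas a version must be measurable, hence `mk`.
  set Z : EuclideanSpace ℝ (Fin d) → Ω → ℝ := fun t ω => (hX.aemeasurable t).mk (X t) ω - μ t
  have hZX : ∀ t, Z t =ᵐ[P] fun ω => X t ω - μ t := fun t => by
    filter_upwards [(hX.aemeasurable t).ae_eq_mk] with ω hω
    simp only [Z, hω]
  obtain ⟨Y, hYm, hYZ, hYc⟩ := exists_continuous_modification P (Z := Z)
    (fun t => (hX.aemeasurable t).measurable_mk.sub_const _) (γ := γ) (by exact_mod_cast hγ) <| by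
    intro p
    obtain ⟨K, hK0, hK⟩ := exists_measureReal_gaussianReal_abs_ge_le p
    refine ⟨K * (2 * C) ^ p, by positivity, fun s t a ha => ?_⟩
    have hset : P.real {ω | a ≤ |Z s ω - Z t ω|} =
        P.real {ω | a ≤ |(X s ω - P[X s]) - (X t ω - P[X t])|} := by
      refine measureReal_congr (eventuallyEq_set.2 ?_)
      filter_upwards [hZX s, hZX t] with ω hs ht
      simp only [hs, ht, hmean]
    rw [hset, hX.measureReal_abs_sub_ge]
    refine (hK _ a ha).trans ?_
    rw [mul_assoc, ← mul_pow, ← mul_div_assoc]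
    gcongr
    rw [Real.coe_toNNReal _ (variance_nonneg _ _)]
    exact hvar s t
  refine ⟨fun t ω => Y t ω + μ t, ⟨fun t => (hYm t).add_const _, fun t => ?_⟩,
    ae_of_all _ fun ω => (hYc ω).add hμ⟩
  filter_upwards [hYZ t, hZX t] with ω h1 h2
  rw [h1, h2, sub_add_cancel]
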